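/- Let $\mathbb R^d=\mathbb R^{d_1}\times\cdots\times\mathbb R^{d_n}$, let each $\mathbb R^{d_k}$ carry a norm $\|\cdot\|$ with dual norm $\|z\|_*=\sup_{\|x\|\le 1}\langle z,x\rangle$, and let $\mathrm{pr}_k:\mathbb R^d\to\mathbb R^{d_k}$, $\mathrm{pr}_k(\xi)=\xi_k$, be the projection onto the $k$-th block. Vector inequalities $\preceq,\succeq$ are componentwise and $[N]=\{1,\dots,N\}$. Let $\Xi=\{\xi\in\mathbb R^d: C\xi\preceq f\}$ be a polyhedral set, let $Q=\sum_{l=1}^M\vartheta_l\delta_{\xi^l}$ with atoms $\xi^l\in\Xi$ and masses $\vartheta_l\ge 0$, $\sum_l\vartheta_l=1$, let $\bm\varepsilon=(\varepsilon_1,\dots,\varepsilon_n)\succeq 0$, and let $\mathcal T_1(Q,\bm\varepsilon)$ be the multi-transport hyperrectangle, i.e. the set of all second marginals of probability measures $\pi$ on $\Xi\times\Xi$ whose first marginal is $Q$ and which satisfy $$\int_{\Xi\times\Xi}\|\zeta_k-\xi_k\|\,d\pi(\zeta,\xi)\le\varepsilon_k\quad\text{for all }k\in[n].$$ **(i) Unions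 of polyhedral sets.** Let $m\ge 1$, let $\mathbb A_j=\{\xi\in\mathbb R^d:A_j\xi\preceq b_j\}$, $j\in[m]$, each have nonempty intersection with $\Xi$, and let $\mathbb A=\bigcup_{j=1}^m\mathbb A_j$. Then $\sup_{P\in\mathcal T_1(Q,\bm\varepsilon)}P(\xi\in\mathbb A)$ equals the value of the convex program $$\begin{aligned} \inf_{\bm\lambda,s_l,\gamma_{lj},\theta_{lj}}\ &\langle\bm\lambda,\bm\varepsilon\rangle+\sum_{l=1}^M\vartheta_l s_l\\ \text{s.t. }\ &1+\langle\theta_{lj},b_j-A_j\xi^l\rangle+\langle\gamma_{lj},f-C\xi^l\rangle\le s_l && l\in[M],\ j\in[m]\\ &\|\mathrm{pr}_k(A_j^\top\theta_{lj}+C^\top\gamma_{lj})\|_*\le\lambda_k && l\in[M],\ j\in[m],\ k\in[n]\\ &\gamma_{lj}\succeq 0,\ \theta_{lj}\succeq 0,\ s_l\ge 0 && l\in[M],\ j\in[m]. \end{aligned}$$ **(ii) Complements of unions of polyhedral sets.** Let $\mathbb A_j=\{\xi\in\mathbb R^d:\langle a_j^i,\xi\rangle<b_j^i\text{ for all }i\in[\alpha_j]\}$,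 $j\in[m]$, and $\mathbb A=\bigcup_{j=1}^m\mathbb A_j$. For $q=(q_1,\dots,q_m)\in\prod_{j=1}^m[\alpha_j]$ let $A_q\in\mathbb R^{m\times d}$ be the matrix with rows $(a_j^{q_j})^\top$ and let $b_q=(b_1^{q_1},\dots,b_m^{q_m})$; let $\mathcal Q$ be the set of those $q$ for which $\{\xi\in\mathbb R^d:A_q\xi\succeq b_q\}$ has nonempty intersection with $\Xi$. Then $\sup_{P\in\mathcal T_1(Q,\bm\varepsilon)}P(\xi\notin\mathbb A)$ equals the value of the convex program $$\begin{aligned} \inf_{\bm\lambda,s_l,\gamma_{lq},\theta_{lq}}\ &\langle\bm\lambda,\bm\varepsilon\rangle+\sum_{l=1}^M\vartheta_l s_l\\ \text{s.t. }\ &1-\langle\theta_{lq},b_q-A_q\xi^l\rangle+\langle\gamma_{lq},f-C\xi^l\rangle\le s_l && l\in[M],\ q\in\mathcal Q\\ &\|\mathrm{pr}_k(C^\top\gamma_{lq}-A_q^\top\theta_{lq})\|_*\le\lambda_k && l\in[M],\ q\in\mathcal Q,\ k\in[n]\\ &\gamma_{lq}\succeq 0,\ \theta_{lq}\succeq 0,\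 s_l\ge 0,\ \bm\lambda\succeq 0 && l\in[M],\ q\in\mathcal Q. \end{aligned}$$ (The constraint $\bm\lambda\succeq 0$ follows from the others unless $\mathcal Q=\emptyset$.) -/

import Mathlib

open MeasureTheory
open scoped Matrix ENNReal

noncomputable section

namespace MTH

/-- `ℝᵈ = ℝ^{d₁} × ⋯ × ℝ^{dₙ}`, with coordinates indexed by the pairs
(block `k`, position inside the block). -/
abbrev BlockSpace {n : ℕ} (d : Fin n → ℕ) : Type := ((k : Fin n) × Fin (d k)) → ℝ

/-- The projection `pr_k` of a vector onto its `k`-th block. -/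
def pr {n : ℕ} {d : Fin n → ℕ} (k : Fin n) (x : BlockSpace d) : Fin (d k) → ℝ :=
  fun i => x ⟨k, i⟩

/-- The dual norm `‖z‖_* = sup_{‖x‖ ≤ 1} ⟨z, x⟩`. -/
def dualNorm {m : ℕ} (N : Seminorm ℝ (Fin m → ℝ)) (z : Fin m → ℝ) : ℝ :=
  ⨆ x : {x : Fin m → ℝ // N x ≤ 1}, z ⬝ᵥ x.1

/-- The polyhedron `{x : A x ⪯ b}`. -/
def polyhedron {ι κ : Type*} [Fintype κ] (A : Matrix ι κ ℝ) (b : ι → ℝ) : Set (κ → ℝ) :=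
  {x | A *ᵥ x ≤ b}

/-- The discrete measure with atoms `ξ l` of mass `ϑ l`. -/
def discreteMeasure {X : Type*} [MeasurableSpace X] {M : ℕ}
    (ϑ : Fin M → ℝ) (ξ : Fin M → X) : Measure X :=
  ∑ l, ENNReal.ofReal (ϑ l) • Measure.dirac (ξ l)

/-- The multi-transport hyperrectangle `𝒯₁(Q, ε)`: the second marginals of the probability
measures on `Ξ × Ξ` whose first marginal is `Q` and whose transport cost in the `k`-th block,
measured by the norm `N k`, is at most `ε k`, for every `k`. Measures on `Ξ` are regarded as
measures on the ambient space that give no mass to the complement of `Ξ`. -/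
def transportHyperrectangle {n : ℕ} {d : Fin n → ℕ}
    (N : ∀ k, Seminorm ℝ (Fin (d k) → ℝ)) (Ξ : Set (BlockSpace d))
    (Q : Measure (BlockSpace d)) (ε : Fin n → ℝ) : Set (Measure (BlockSpace d)) :=
  {P | ∃ π : Measure (BlockSpace d × BlockSpace d),
    IsProbabilityMeasure π ∧
    π (Ξ ×ˢ Ξ)ᶜ = 0 ∧
    π.map Prod.fst = Q ∧
    (∀ k, ∫⁻ z, ENNReal.ofReal (N k (pr k z.1 - pr k z.2)) ∂π ≤ ENNReal.ofReal (ε k)) ∧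
    π.map Prod.snd = P}

/-- The worst-case probability `sup_{P ∈ 𝒜} P(S)`. -/
def worstCaseProb {X : Type*} [MeasurableSpace X] (𝒜 : Set (Measure X)) (S : Set X) : EReal :=
  ⨆ P ∈ 𝒜, ((P.real S : ℝ) : EReal)

/-- The decision variables of the programs below: multipliers `lam k`, epigraphical variables
`s l`, and the multipliers `θ l j`, `γ l j`, where `j` ranges over an index type `J`, `θ l j`
has entries indexed by `R j`, and `γ l j` has `r` entries. -/
abbrev Variables (n M r : ℕ) (J : Type) (R : J → Type) : Type :=
  (Fin n → ℝ) × (Fin M → ℝ) × (Fin M → (j : J) → R j → ℝ) × (Fin M → J → Fin r → ℝ)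

/-- The objective `⟨λ, ε⟩ + ∑ l, ϑ l * s l`. -/
def objective {n M r : ℕ} {J : Type} {R : J → Type} (ε : Fin n → ℝ) (ϑ : Fin M → ℝ)
    (x : Variables n M r J R) : ℝ :=
  x.1 ⬝ᵥ ε + ∑ l, ϑ l * x.2.1 l

/-- The value of the program of minimizing `obj` over `F`
(`⊤` for an infeasible and `⊥` for an unbounded program). -/
def programValue {V : Type*} (F : Set V) (obj : V → ℝ) : EReal :=
  ⨅ x ∈ F, ((obj x : ℝ) : EReal)

/-- The feasible set of the program for the union of the polyhedra `{x : A j x ⪯ b j}`. -/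
def unionFeasible {n : ℕ} {d : Fin n → ℕ} {M r m : ℕ} {ρ : Fin m → ℕ}
    (N : ∀ k, Seminorm ℝ (Fin (d k) → ℝ))
    (C : Matrix (Fin r) ((k : Fin n) × Fin (d k)) ℝ) (f : Fin r → ℝ)
    (ξ : Fin M → BlockSpace d)
    (A : ∀ j, Matrix (Fin (ρ j)) ((k : Fin n) × Fin (d k)) ℝ) (b : ∀ j, Fin (ρ j) → ℝ) :
    Set (Variables n M r (Fin m) (fun j => Fin (ρ j))) :=
  {(lam, s, θ, γ) |
    (∀ l j, 1 + θ l j ⬝ᵥ (b j - A j *ᵥ ξ l) + γ l j ⬝ᵥ (f - C *ᵥ ξ l) ≤ s l) ∧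
    (∀ l j k, dualNorm (N k) (pr k ((A j)ᵀ *ᵥ θ l j + Cᵀ *ᵥ γ l j)) ≤ lam k) ∧
    (∀ l j, 0 ≤ γ l j) ∧ (∀ l j, 0 ≤ θ l j) ∧ (∀ l, 0 ≤ s l)}

/-- The matrix `A_q`, whose `j`-th row is `a_j^{q_j}`. -/
def selectRows {κ : Type*} {m : ℕ} {α : Fin m → ℕ} (a : ∀ j, Fin (α j) → κ → ℝ)
    (q : ∀ j, Fin (α j)) : Matrix (Fin m) κ ℝ :=
  Matrix.of fun j => a j (q j)

/-- The vector `b_q`, whose `j`-th entry is `b_j^{q_j}`. -/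
def selectEntries {m : ℕ} {α : Fin m → ℕ} (b : ∀ j, Fin (α j) → ℝ)
    (q : ∀ j, Fin (α j)) : Fin m → ℝ :=
  fun j => b j (q j)

/-- The index set of the tuples `q` for which `{x : A_q x ⪰ b_q}` meets `Ξ`. -/
abbrev Selection {κ : Type*} [Fintype κ] {m : ℕ} {α : Fin m → ℕ} (Ξ : Set (κ → ℝ))
    (a : ∀ j, Fin (α j) → κ → ℝ) (b : ∀ j, Fin (α j) → ℝ) : Type :=
  {q : ∀ j, Fin (α j) // ({x | selectEntries b q ≤ selectRows a q *ᵥ x} ∩ Ξ).Nonempty}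

/-- The feasible set of the program for the complement of the union of the open polyhedra
`{x : ⟨a_j^i, x⟩ < b_j^i for all i}`. The constraint `0 ≤ lam` follows from the dual norm
constraints unless no tuple `q` is selected. -/
def complementFeasible {n : ℕ} {d : Fin n → ℕ} {M r m : ℕ} {α : Fin m → ℕ}
    (N : ∀ k, Seminorm ℝ (Fin (d k) → ℝ))
    (C : Matrix (Fin r) ((k : Fin n) × Fin (d k)) ℝ) (f : Fin r → ℝ)
    (ξ : Fin M → BlockSpace d)
    (a : ∀ j, Fin (α j) → BlockSpace d) (b : ∀ j, Fin (α j) → ℝ) :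
    Set (Variables n M r (Selection (polyhedron C f) a b) (fun _ => Fin m)) :=
  {(lam, s, θ, γ) |
    (∀ l q, 1 - θ l q ⬝ᵥ (selectEntries b q.1 - selectRows a q.1 *ᵥ ξ l)
        + γ l q ⬝ᵥ (f - C *ᵥ ξ l) ≤ s l) ∧
    (∀ l q k, dualNorm (N k) (pr k (Cᵀ *ᵥ γ l q - (selectRows a q.1)ᵀ *ᵥ θ l q)) ≤ lam k) ∧
    (∀ l q, 0 ≤ γ l q) ∧ (∀ l q, 0 ≤ θ l q) ∧ (∀ l, 0 ≤ s l) ∧ 0 ≤ lam}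

end MTH

end

/-! The argument is linear programming duality between moving mass and pricing its displacement.
Weak duality: if `1 ≤ s l + ∑ k, lam k * ‖ξ_k^l - x_k‖` for every atom and every `x` of the target
set in `Ξ`, then integrating this inequality against a transport plan bounds the probability of the
target by the objective.

For the converse, let mass `u l j` move from `ξ l` into the `j`-th polyhedron with mass-weighted
displacement `y l j`. The resulting pairs (cost vector, moved mass) form a convex set
(`convex_attainable`), which is closed because bounded costs bound the displacements
(`isClosed_attainable`). If `v` exceeds the worst-case probability, then `(ε, v)` lies outside this
set and is strictly separated from it. Closedness replaces a Slater condition, so budgets `ε k = 0`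
are allowed. The separating functional yields prices `lam`, and `s l` is the largest profit that a
unit of mass at `ξ l` can earn (`exists_prices_and_profits`).

It remains to replace the infinitely many constraints indexed by `x` by multipliers. For fixed `lam`
and `s` they say that a convex function is nonnegative on a nonempty polyhedron. Hahn-Banach and the
affine Farkas lemma then give a nonnegative Lagrangian (`exists_multipliers_of_convexOn`), whose
value at zero displacement and whose growth along rays are the two families of constraints of the
program. Part (ii) reduces to the same duality: a point is outside a union of open polyhedra iff it
violates one inequality of each, and each choice `q` of violated inequalities defines a closed
polyhedron. -/

noncomputable section

namespace MTH

/-! ### Farkas' lemma and Lagrange multipliers over polyhedra -/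

/-- **Farkas' lemma** for finitely many linear functionals. -/
theorem exists_nonneg_combination_finset {E ι : Type*} [AddCommGroup E] [Module ℝ E]
    [DecidableEq ι] (s : Finset ι) :
    ∀ (a : ι → E →ₗ[ℝ] ℝ) (c : E →ₗ[ℝ] ℝ),
      (∀ x, (∀ i ∈ s, a i x ≤ 0) → c x ≤ 0) →
      ∃ η : ι → ℝ, 0 ≤ η ∧ c = ∑ i ∈ s, η i • a i := by
  induction s using Finset.induction_on with
  | empty =>
    intro a c h
    refine ⟨0, le_rfl, ?_⟩
    ext x
    have h1 := h x (by simp)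
    have h2 := h (-x) (by simp)
    rw [map_neg] at h2
    simp only [Finset.sum_empty, LinearMap.zero_apply]
    linarith
  | insert i₀ s hi ih =>
    intro a c h
    by_cases hc : ∀ x, (∀ i ∈ s, a i x ≤ 0) → c x ≤ 0
    · obtain ⟨η, hη, hs⟩ := ih a c hc
      refine ⟨Function.update η i₀ 0, ?_, ?_⟩
      · intro i
        by_cases hii : i = i₀
        · subst hii; simp
        · simpa [Function.update_of_ne hii] using hη i
      · rw [Finset.sum_insert hi, hs]
        simp only [Function.update_self, zero_smul, zero_add]
        refine Finset.sum_congr rfl fun i his => ?_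
        rw [Function.update_of_ne (ne_of_mem_of_not_mem his hi)]
    · push Not at hc
      obtain ⟨x₀, hx₀, hcx₀⟩ := hc
      have hpos : 0 < a i₀ x₀ := by
        by_contra hle
        refine absurd (h x₀ fun i hi' => ?_) (not_le.2 hcx₀)
        rcases Finset.mem_insert.1 hi' with rfl | hi'
        · exact not_lt.1 hle
        · exact hx₀ i hi'
      -- The modified functionals vanish at `x₀`: they are the old ones composed with the projection
      -- along `x₀` onto the kernel of `a i₀`, where the constraint `i₀` holds with equality.
      obtain ⟨η, hη, hs⟩ := ih (fun i => a i - (a i x₀ / a i₀ x₀) • a i₀)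
        (c - (c x₀ / a i₀ x₀) • a i₀) (fun x hx => by
          have hz := h (x - (a i₀ x / a i₀ x₀) • x₀) (fun i hi' => by
            rcases Finset.mem_insert.1 hi' with rfl | hi'
            · simp only [map_sub, map_smul, smul_eq_mul]
              rw [div_mul_cancel₀ _ hpos.ne', sub_self]
            · have := hx i hi'
              simp only [LinearMap.sub_apply, LinearMap.smul_apply, map_sub, map_smul,
                smul_eq_mul] at this ⊢
              convert this using 2
              ring)
          simp only [LinearMap.sub_apply, LinearMap.smul_apply, map_sub, map_smul,
            smul_eq_mul] at hz ⊢
          convert hz using 2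
          ring)
      -- Evaluation at `x₀` forces this coefficient of `a i₀`; it is nonnegative because `c x₀ > 0`
      -- while `a i x₀ ≤ 0` on `s`.
      refine ⟨Function.update η i₀ ((c x₀ - ∑ i ∈ s, η i * a i x₀) / a i₀ x₀), ?_, ?_⟩
      · intro i
        by_cases hii : i = i₀
        · subst hii
          simp only [Function.update_self, Pi.zero_apply]
          refine div_nonneg (sub_nonneg.2 (le_trans (Finset.sum_nonpos fun j hj => ?_) hcx₀.le))
            hpos.le
          exact mul_nonpos_of_nonneg_of_nonpos (hη j) (hx₀ j hj)
        · simpa [Function.update_of_ne hii] using hη i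
      · have hsum : ∑ i ∈ s, Function.update η i₀
            ((c x₀ - ∑ i ∈ s, η i * a i x₀) / a i₀ x₀) i • a i = ∑ i ∈ s, η i • a i :=
          Finset.sum_congr rfl fun i his => by
            rw [Function.update_of_ne (ne_of_mem_of_not_mem his hi)]
        rw [Finset.sum_insert hi, hsum, Function.update_self]
        ext x
        have hx := LinearMap.congr_fun hs x
        simp only [LinearMap.sub_apply, LinearMap.smul_apply, LinearMap.sum_apply,
          LinearMap.add_apply, smul_eq_mul] at hx ⊢
        have : ∑ i ∈ s, η i * (a i x - a i x₀ / a i₀ x₀ * a i₀ x)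
            = ∑ i ∈ s, η i * a i x - (∑ i ∈ s, η i * a i x₀) / a i₀ x₀ * a i₀ x := by
          rw [Finset.sum_div, Finset.sum_mul, ← Finset.sum_sub_distrib]
          exact Finset.sum_congr rfl fun i _ => by ring
        rw [this] at hx
        rw [sub_div, sub_mul]
        linarith

/-- **Affine Farkas' lemma**: an affine inequality valid on a nonempty polyhedron is a
nonnegative combination of the inequalities that define the polyhedron. -/
theorem exists_multipliers_of_le_on_polyhedron {ι κ : Type*} [Fintype ι] [Fintype κ]
    (G : Matrix ι κ ℝ) (g : ι → ℝ) (hne : (polyhedron G g).Nonempty)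
    (u : (κ → ℝ) →ₗ[ℝ] ℝ) (w : ℝ) (h : ∀ x ∈ polyhedron G g, u x ≤ w) :
    ∃ η : ι → ℝ, 0 ≤ η ∧ (∀ x, u x = η ⬝ᵥ (G *ᵥ x)) ∧ η ⬝ᵥ g ≤ w := by
  classical
  obtain ⟨x₀, hx₀⟩ := hne
  let row (i : ι) : (κ → ℝ) →ₗ[ℝ] ℝ := LinearMap.proj i ∘ₗ G.mulVecLin
  -- Homogenization by an extra coordinate `t`: `some i` encodes `(G x) i ≤ g i * t`, and `none`
  -- encodes `0 ≤ t`.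
  let a : Option ι → ((κ → ℝ) × ℝ) →ₗ[ℝ] ℝ := fun o =>
    o.elim (-LinearMap.snd ℝ _ _) fun i => (row i).coprod (-(g i) • LinearMap.id)
  have ha : ∀ i x t, a (some i) (x, t) = (G *ᵥ x) i - g i * t := by
    intro i x t
    simp [a, row, sub_eq_add_neg]
  have ha' : ∀ x t, a none (x, t) = -t := by intro x t; simp [a]
  obtain ⟨η, hη, hs⟩ := exists_nonneg_combination_finset Finset.univ a
    (u.coprod (-w • LinearMap.id)) (by
      rintro ⟨x, t⟩ hx
      have ht : 0 ≤ t := by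
        have := hx none (Finset.mem_univ _)
        rw [ha'] at this
        linarith
      have hG : ∀ i, (G *ᵥ x) i ≤ g i * t := fun i => by
        have := hx (some i) (Finset.mem_univ _)
        rw [ha] at this
        linarith
      -- Mixing in the feasible point `x₀` makes the scaling factor positive even for `t = 0`, so
      -- recession directions need no separate case. A large `c` then gives `u x ≤ w * t`.
      have key : ∀ c : ℝ, 0 ≤ c → 0 < 1 + c * t →
          u x₀ + c * u x ≤ w * (1 + c * t) := fun c hc hpos => by
        have hmem : (1 + c * t)⁻¹ • (x₀ + c • x) ∈ polyhedron G g := by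
          intro i
          rw [Matrix.mulVec_smul, Matrix.mulVec_add, Matrix.mulVec_smul]
          simp only [Pi.smul_apply, Pi.add_apply, smul_eq_mul]
          rw [inv_mul_le_iff₀ hpos]
          have h1 := hx₀ i
          have h2 := mul_le_mul_of_nonneg_left (hG i) hc
          linarith
        have := h _ hmem
        rw [map_smul, map_add, map_smul, smul_eq_mul, smul_eq_mul, inv_mul_le_iff₀ hpos] at this
        linarith
      simp only [LinearMap.coprod_apply, LinearMap.smul_apply, LinearMap.id_apply, smul_eq_mul]
      by_contra hcon
      push Not at hcon
      set e := u x + -w * t with he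
      have hk := key ((|w - u x₀| + 1) / e) (by positivity) (by positivity)
      have : (|w - u x₀| + 1) / e * e = |w - u x₀| + 1 := div_mul_cancel₀ _ hcon.ne'
      have habs := le_abs_self (w - u x₀)
      rw [he] at this
      nlinarith)
  rw [Fintype.sum_option] at hs
  refine ⟨fun i => η (some i), fun i => hη _, fun x => ?_, ?_⟩
  · have := LinearMap.congr_fun hs (x, 0)
    simp only [LinearMap.coprod_apply, map_zero, add_zero, LinearMap.sum_apply,
      LinearMap.smul_apply, LinearMap.add_apply, ha, ha', smul_eq_mul, mul_zero, neg_zero,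
      sub_zero, zero_add] at this
    simpa [dotProduct] using this
  · have := LinearMap.congr_fun hs (0, 1)
    simp only [LinearMap.coprod_apply, map_zero, LinearMap.sum_apply,
      LinearMap.smul_apply, LinearMap.add_apply, ha, ha', smul_eq_mul, LinearMap.id_apply,
      Matrix.mulVec_zero, Pi.zero_apply, zero_sub, mul_one, zero_add, mul_neg,
      Finset.sum_neg_distrib] at this
    have h0 := hη none
    simp only [Pi.zero_apply] at h0
    simp only [dotProduct]
    linarith

/-- A convex function that is nonnegative on a nonempty polyhedron has a nonnegative
Lagrangian for suitable multipliers. -/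
theorem exists_multipliers_of_convexOn {ι κ : Type*} [Fintype ι] [Fintype κ]
    (G : Matrix ι κ ℝ) (g : ι → ℝ) (hne : (polyhedron G g).Nonempty)
    (h : (κ → ℝ) → ℝ) (hconv : ConvexOn ℝ Set.univ h)
    (hnonneg : ∀ x ∈ polyhedron G g, 0 ≤ h x) :
    ∃ η : ι → ℝ, 0 ≤ η ∧ ∀ x, 0 ≤ h x + η ⬝ᵥ (G *ᵥ x - g) := by
  have hcont : Continuous h :=
    continuousOn_univ.1 (hconv.continuousOn isOpen_univ)
  have hepi : Convex ℝ {z : (κ → ℝ) × ℝ | h z.1 < z.2} := by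
    simpa using hconv.convex_strict_epigraph
  have hopen : IsOpen {z : (κ → ℝ) × ℝ | h z.1 < z.2} :=
    isOpen_lt (hcont.comp continuous_fst) continuous_snd
  have hpoly : Convex ℝ (polyhedron G g) := by
    intro x hx y hy s t hs ht hst
    simp only [polyhedron, Set.mem_ofPred_eq] at hx hy ⊢
    rw [Matrix.mulVec_add, Matrix.mulVec_smul, Matrix.mulVec_smul]
    calc s • G *ᵥ x + t • G *ᵥ y ≤ s • g + t • g := by gcongr
      _ = g := by rw [← add_smul, hst, one_smul]
  -- The open strict epigraph of `h` is separated from the polyhedron times the nonpositive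
  -- half-line.
  obtain ⟨φ, c, hφ, hφ'⟩ := geometric_hahn_banach_open hepi hopen
    (hpoly.prod (convex_Iic (0 : ℝ))) (by
      rw [Set.disjoint_left]
      rintro ⟨x, t⟩ hx ⟨hxp, ht⟩
      simp only [Set.mem_ofPred_eq, Set.mem_Iic] at hx ht
      linarith [hnonneg x hxp])
  obtain ⟨x₀, hx₀⟩ := hne
  have hsplit : ∀ x t, φ (x, t) = φ (x, 0) + t * φ (0, 1) := fun x t => by
    rw [← smul_eq_mul, ← map_smul, ← map_add]
    simp
  have hx₀c := hφ' (x₀, 0) ⟨hx₀, Set.mem_Iic.2 le_rfl⟩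
  set β := φ (0, 1) with hβ
  -- The hyperplane is not vertical, since the epigraph has points above `x₀`. As `h` is finite
  -- everywhere, no interior point of the polyhedron is needed.
  have hβneg : β < 0 := by
    have := hφ (x₀, h x₀ + 1) (by simp)
    rw [hsplit] at this
    have h0 := hnonneg x₀ hx₀
    nlinarith
  have hbound : ∀ x, φ (x, 0) + h x * β ≤ c := fun x => by
    refine le_of_forall_pos_lt_add fun δ hδ => ?_
    have := hφ (x, h x + δ / (-β)) (by
      simp only [Set.mem_ofPred_eq]
      linarith [div_pos hδ (neg_pos.2 hβneg)])
    rw [hsplit, add_mul, div_mul_eq_mul_div, mul_div_assoc,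
      show β / -β = -1 by rw [div_neg, div_self hβneg.ne]] at this
    linarith
  obtain ⟨η, hη, hηG, hηg⟩ := exists_multipliers_of_le_on_polyhedron G g ⟨x₀, hx₀⟩
    ((β⁻¹ • φ).toLinearMap ∘ₗ LinearMap.inl ℝ _ _) (β⁻¹ * c) (fun x hx => by
      have := hφ' (x, 0) ⟨hx, Set.mem_Iic.2 le_rfl⟩
      simpa using mul_le_mul_of_nonpos_left this (inv_nonpos.2 hβneg.le))
  refine ⟨η, hη, fun x => ?_⟩
  rw [dotProduct_sub, ← hηG x]
  have h1 := mul_le_mul_of_nonpos_left (hbound x) (inv_nonpos.2 hβneg.le)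
  rw [mul_add, mul_comm (h x) β, inv_mul_cancel_left₀ hβneg.ne] at h1
  simp only [LinearMap.coe_comp, Function.comp_apply, LinearMap.coe_inl]
  change 0 ≤ h x + (β⁻¹ * φ (x, 0) - η ⬝ᵥ g)
  linarith

/-! ### Norms and dual norms in finite dimension -/

theorem continuous_seminorm_pi {κ : Type*} [Fintype κ] (N : Seminorm ℝ (κ → ℝ)) :
    Continuous N :=
  continuousOn_univ.1 (N.convexOn.continuousOn isOpen_univ)

/-- On a finite-dimensional space every norm dominates a multiple of the standard one. -/
theorem exists_pos_mul_norm_le {κ : Type*} [Fintype κ] (N : Seminorm ℝ (κ → ℝ))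
    (hN : ∀ x, N x = 0 → x = 0) : ∃ c : ℝ, 0 < c ∧ ∀ x, c * ‖x‖ ≤ N x := by
  rcases (Metric.sphere (0 : κ → ℝ) 1).eq_empty_or_nonempty with he | hne
  · refine ⟨1, one_pos, fun x => ?_⟩
    have hx : ‖x‖ = 0 := by
      by_contra hx
      have : ‖x‖⁻¹ • x ∈ Metric.sphere (0 : κ → ℝ) 1 := by
        rw [mem_sphere_zero_iff_norm, norm_smul, norm_inv, norm_norm, inv_mul_cancel₀ hx]
      rw [he] at this
      exact this
    rw [hx, mul_zero]
    exact apply_nonneg N x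
  · obtain ⟨x₀, hx₀, hmin⟩ := (isCompact_sphere (0 : κ → ℝ) 1).exists_isMinOn hne
      (continuous_seminorm_pi N).continuousOn
    rw [mem_sphere_zero_iff_norm] at hx₀
    refine ⟨N x₀, lt_of_le_of_ne (apply_nonneg N x₀) fun h => ?_, fun x => ?_⟩
    · rw [hN x₀ h.symm, norm_zero] at hx₀
      exact zero_ne_one hx₀
    · rcases eq_or_ne x 0 with rfl | hx
      · simp
      · have hx' := norm_pos_iff.2 hx
        have : ‖x‖⁻¹ • x ∈ Metric.sphere (0 : κ → ℝ) 1 := by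
          rw [mem_sphere_zero_iff_norm, norm_smul, norm_inv, norm_norm, inv_mul_cancel₀ hx'.ne']
        have h := hmin this
        simp only [Set.mem_ofPred_eq, map_smul_eq_mul, norm_inv, norm_norm] at h
        rw [inv_mul_eq_div, le_div_iff₀ hx'] at h
        exact h

/-- Homogeneity passes from the unit ball to all vectors. Definiteness of `N` bounds the supremum,
which as a real `⨆` would otherwise take a default value; `0 ≤ c` comes from `x = 0`. -/
theorem dualNorm_le_iff {m : ℕ} (N : Seminorm ℝ (Fin m → ℝ)) (hN : ∀ x, N x = 0 → x = 0)
    (z : Fin m → ℝ) (c : ℝ) : dualNorm N z ≤ c ↔ 0 ≤ c ∧ ∀ x, z ⬝ᵥ x ≤ c * N x := by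
  have hbdd : BddAbove (Set.range fun x : {x : Fin m → ℝ // N x ≤ 1} => z ⬝ᵥ x.1) := by
    obtain ⟨a, ha, hle⟩ := exists_pos_mul_norm_le N hN
    refine ⟨∑ i, |z i| * a⁻¹, ?_⟩
    rintro _ ⟨⟨x, hx⟩, rfl⟩
    refine Finset.sum_le_sum fun i _ => ?_
    calc z i * x i ≤ |z i| * |x i| := by rw [← abs_mul]; exact le_abs_self _
      _ ≤ |z i| * a⁻¹ := by
        gcongr
        have h1 := norm_le_pi_norm x i
        have h2 := (hle x).trans hx
        rw [Real.norm_eq_abs] at h1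
        rw [mul_comm, ← le_div_iff₀ ha, one_div] at h2
        exact h1.trans h2
  constructor
  · intro h
    have hx : ∀ x, N x ≤ 1 → z ⬝ᵥ x ≤ c := fun x hx => (le_ciSup hbdd ⟨x, hx⟩).trans h
    refine ⟨by simpa using hx 0 (by simp), fun x => ?_⟩
    rcases (apply_nonneg N x).eq_or_lt with h0 | h0
    · rw [hN x h0.symm]; simp
    · have := hx ((N x)⁻¹ • x) (by
        rw [map_smul_eq_mul, Real.norm_eq_abs, abs_of_pos (inv_pos.2 h0), inv_mul_cancel₀ h0.ne'])
      rw [dotProduct_smul, smul_eq_mul, inv_mul_le_iff₀ h0] at this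
      linarith
  · rintro ⟨hc, h⟩
    have : Nonempty {x : Fin m → ℝ // N x ≤ 1} := ⟨0, by simp⟩
    exact ciSup_le fun x => (h x).trans (mul_le_of_le_one_right hc x.2)

/-! ### Multipliers certifying the cost of reaching a polyhedron -/

section Blocks

variable {n : ℕ} {d : Fin n → ℕ}

theorem dotProduct_eq_sum_pr (z x : BlockSpace d) : z ⬝ᵥ x = ∑ k, pr k z ⬝ᵥ pr k x := by
  simp only [dotProduct, pr]
  exact Fintype.sum_sigma _

/-- The seminorm `x ↦ N (pr_k x)`. -/
def blockSeminorm (N : ∀ k, Seminorm ℝ (Fin (d k) → ℝ)) (k : Fin n) :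
    Seminorm ℝ (BlockSpace d) :=
  (N k).comp (LinearMap.funLeft ℝ ℝ fun i => ⟨k, i⟩)

theorem blockSeminorm_apply (N : ∀ k, Seminorm ℝ (Fin (d k) → ℝ)) (k : Fin n)
    (x : BlockSpace d) : blockSeminorm N k x = N k (pr k x) := rfl

theorem dotProduct_le_of_dualNorm_le (N : ∀ k, Seminorm ℝ (Fin (d k) → ℝ))
    (hN : ∀ k x, N k x = 0 → x = 0) (lam : Fin n → ℝ) (z x : BlockSpace d)
    (h : ∀ k, dualNorm (N k) (pr k z) ≤ lam k) :
    z ⬝ᵥ x ≤ ∑ k, lam k * blockSeminorm N k x := by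
  rw [dotProduct_eq_sum_pr]
  exact Finset.sum_le_sum fun k _ => ((dualNorm_le_iff _ (hN k) _ _).1 (h k)).2 _

theorem polyhedron_fromRows {ι ι' κ : Type*} [Fintype κ] (A : Matrix ι κ ℝ) (b : ι → ℝ)
    (C : Matrix ι' κ ℝ) (f : ι' → ℝ) :
    polyhedron (Matrix.fromRows A C) (Sum.elim b f) = polyhedron A b ∩ polyhedron C f := by
  ext x
  simp [polyhedron, Matrix.fromRows_mulVec, Sum.elim_le_elim_iff]

theorem dotProduct_mulVec_transpose {ι κ : Type*} [Fintype ι] [Fintype κ] (A : Matrix ι κ ℝ)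
    (θ : ι → ℝ) (x : κ → ℝ) : θ ⬝ᵥ (A *ᵥ x) = (Aᵀ *ᵥ θ) ⬝ᵥ x := by
  rw [Matrix.dotProduct_mulVec, Matrix.mulVec_transpose]

/-- Feasibility of multipliers certifies the lower bound on the cost of reaching the
polyhedron. -/
theorem one_le_of_multipliers (N : ∀ k, Seminorm ℝ (Fin (d k) → ℝ))
    (hN : ∀ k x, N k x = 0 → x = 0) {ι ι' : Type*} [Fintype ι] [Fintype ι']
    (A : Matrix ι ((k : Fin n) × Fin (d k)) ℝ) (b : ι → ℝ)
    (C : Matrix ι' ((k : Fin n) × Fin (d k)) ℝ) (f : ι' → ℝ)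
    (ξ : BlockSpace d) (lam : Fin n → ℝ) (s : ℝ) (θ : ι → ℝ) (γ : ι' → ℝ)
    (hs : 1 + θ ⬝ᵥ (b - A *ᵥ ξ) + γ ⬝ᵥ (f - C *ᵥ ξ) ≤ s)
    (hlam : ∀ k, dualNorm (N k) (pr k (Aᵀ *ᵥ θ + Cᵀ *ᵥ γ)) ≤ lam k)
    (hγ : 0 ≤ γ) (hθ : 0 ≤ θ) (x : BlockSpace d)
    (hxA : x ∈ polyhedron A b) (hxC : x ∈ polyhedron C f) :
    1 ≤ s + ∑ k, lam k * blockSeminorm N k (ξ - x) := by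
  have h1 := dotProduct_le_of_dualNorm_le N hN lam _ (ξ - x) hlam
  rw [add_dotProduct, ← dotProduct_mulVec_transpose, ← dotProduct_mulVec_transpose] at h1
  have h2 : 0 ≤ θ ⬝ᵥ (b - A *ᵥ x) := dotProduct_nonneg_of_nonneg hθ (sub_nonneg.2 hxA)
  have h3 : 0 ≤ γ ⬝ᵥ (f - C *ᵥ x) := dotProduct_nonneg_of_nonneg hγ (sub_nonneg.2 hxC)
  simp only [Matrix.mulVec_sub, dotProduct_sub] at *
  linarith

/-- Conversely, a lower bound on the cost of reaching a nonempty polyhedron is certified by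
feasible multipliers. -/
theorem exists_multipliers_of_one_le (N : ∀ k, Seminorm ℝ (Fin (d k) → ℝ))
    (hN : ∀ k x, N k x = 0 → x = 0) {ι ι' : Type*} [Fintype ι] [Fintype ι']
    (A : Matrix ι ((k : Fin n) × Fin (d k)) ℝ) (b : ι → ℝ)
    (C : Matrix ι' ((k : Fin n) × Fin (d k)) ℝ) (f : ι' → ℝ)
    (hne : (polyhedron A b ∩ polyhedron C f).Nonempty)
    (ξ : BlockSpace d) (lam : Fin n → ℝ) (hlam : 0 ≤ lam) (s : ℝ)
    (h : ∀ x ∈ polyhedron A b ∩ polyhedron C f,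
      1 ≤ s + ∑ k, lam k * blockSeminorm N k (ξ - x)) :
    ∃ (θ : ι → ℝ) (γ : ι' → ℝ), 0 ≤ θ ∧ 0 ≤ γ ∧
      1 + θ ⬝ᵥ (b - A *ᵥ ξ) + γ ⬝ᵥ (f - C *ᵥ ξ) ≤ s ∧
      ∀ k, dualNorm (N k) (pr k (Aᵀ *ᵥ θ + Cᵀ *ᵥ γ)) ≤ lam k := by
  obtain ⟨η, hη, hL⟩ := exists_multipliers_of_convexOn (Matrix.fromRows A C) (Sum.elim b f)
    (by rwa [polyhedron_fromRows])
    (fun x => s - 1 + ∑ k, lam k * blockSeminorm N k (ξ - x))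
    (by
      refine (convexOn_const _ convex_univ).add ⟨convex_univ, fun x _ y _ a c ha hc hac => ?_⟩
      simp only [smul_eq_mul, Finset.mul_sum, ← Finset.sum_add_distrib]
      refine Finset.sum_le_sum fun k _ => ?_
      have hsplit : ξ - (a • x + c • y) = a • (ξ - x) + c • (ξ - y) := by
        obtain rfl : c = 1 - a := by linarith
        module
      calc lam k * blockSeminorm N k (ξ - (a • x + c • y))
          ≤ lam k * (blockSeminorm N k (a • (ξ - x)) + blockSeminorm N k (c • (ξ - y))) := by
            rw [hsplit]
            exact mul_le_mul_of_nonneg_left (map_add_le_add _ _ _) (hlam k)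
        _ = _ := by
            rw [map_smul_eq_mul, map_smul_eq_mul, Real.norm_of_nonneg ha, Real.norm_of_nonneg hc]
            ring)
    (fun x hx => by
      rw [polyhedron_fromRows] at hx
      linarith [h x hx])
  set θ : ι → ℝ := fun i => η (Sum.inl i)
  set γ : ι' → ℝ := fun i => η (Sum.inr i)
  -- In the displacement `y = ξ - x` the Lagrangian is a constant plus a positively homogeneous
  -- function.
  have hL' : ∀ y : BlockSpace d, 0 ≤ s - 1 + ∑ k, lam k * blockSeminorm N k y
      - (θ ⬝ᵥ (b - A *ᵥ ξ) + γ ⬝ᵥ (f - C *ᵥ ξ)) - (Aᵀ *ᵥ θ + Cᵀ *ᵥ γ) ⬝ᵥ y := fun y => by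
    have := hL (ξ - y)
    have hsum : η ⬝ᵥ (Matrix.fromRows A C *ᵥ (ξ - y) - Sum.elim b f)
        = θ ⬝ᵥ (A *ᵥ (ξ - y) - b) + γ ⬝ᵥ (C *ᵥ (ξ - y) - f) := by
      rw [Matrix.fromRows_mulVec]
      simp [dotProduct, Fintype.sum_sum_type, θ, γ]
    rw [hsum, sub_sub_cancel] at this
    rw [add_dotProduct, ← dotProduct_mulVec_transpose, ← dotProduct_mulVec_transpose]
    simp only [Matrix.mulVec_sub, dotProduct_sub] at this ⊢
    linarith
  refine ⟨θ, γ, fun i => hη _, fun i => hη _, ?_, fun k => ?_⟩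
  · have := hL' 0
    simp only [map_zero, mul_zero, Finset.sum_const_zero, dotProduct_zero] at this
    linarith
  · rw [dualNorm_le_iff _ (hN k)]
    refine ⟨hlam k, fun v => ?_⟩
    set B := s - 1 - (θ ⬝ᵥ (b - A *ᵥ ξ) + γ ⬝ᵥ (f - C *ᵥ ξ))
    -- Displacing only block `k` isolates the price `lam k`.
    let y : BlockSpace d := fun p => Function.update (0 : ∀ k, Fin (d k) → ℝ) k v p.1 p.2
    have hyk : pr k y = v := by ext i; simp [pr, y]
    have hyj : ∀ j, j ≠ k → pr j y = 0 := fun j hj => by ext i; simp [pr, y, hj]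
    have hN' : ∑ j, lam j * blockSeminorm N j y = lam k * N k v := by
      rw [Finset.sum_eq_single k (fun j _ hj => by rw [blockSeminorm_apply, hyj j hj]; simp)
        (by simp), blockSeminorm_apply, hyk]
    have hdot : ∀ z : BlockSpace d, z ⬝ᵥ y = pr k z ⬝ᵥ v := fun z => by
      rw [dotProduct_eq_sum_pr,
        Finset.sum_eq_single k (fun j _ hj => by rw [hyj j hj]; simp) (by simp), hyk]
    -- An affine function of `t` that stays nonnegative for all `t ≥ 0` has nonnegative slope.
    have hray : ∀ t : ℝ, 0 ≤ t → 0 ≤ B + t * (lam k * N k v - pr k (Aᵀ *ᵥ θ + Cᵀ *ᵥ γ) ⬝ᵥ v) :=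
      fun t ht => by
        have := hL' (t • y)
        simp only [map_smul_eq_mul, Real.norm_of_nonneg ht, dotProduct_smul, hdot,
          smul_eq_mul, mul_left_comm _ t, ← Finset.mul_sum, hN'] at this
        simp only [B]
        linarith
    by_contra hcon
    push Not at hcon
    have hpos := sub_pos.2 hcon
    have := hray ((|B| + 1) / (pr k (Aᵀ *ᵥ θ + Cᵀ *ᵥ γ) ⬝ᵥ v - lam k * N k v)) (by positivity)
    rw [← neg_sub (pr k (Aᵀ *ᵥ θ + Cᵀ *ᵥ γ) ⬝ᵥ v), mul_neg, div_mul_cancel₀ _ hpos.ne'] at this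
    linarith [le_abs_self B]

end Blocks

/-! ### Attainable cost-mass pairs and their separation -/

section Attainable

variable {n M : ℕ} {κ J : Type*} [Fintype κ] [Fintype J] {ι : J → Type*}

/-- The pairs of a cost vector and a mass such that at least this mass can be moved from the
points `ξ l`, carrying the masses `w l`, into the polyhedra, at no more than this cost.
The variables are the moved masses `u l j` and the mass-weighted displacements `y l j`. -/
def attainable (p : Fin n → Seminorm ℝ (κ → ℝ)) (w : Fin M → ℝ) (ξ : Fin M → κ → ℝ)
    (G : ∀ j, Matrix (ι j) κ ℝ) (g : ∀ j, ι j → ℝ) : Set ((Fin n → ℝ) × ℝ) :=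
  {z | ∃ (u : Fin M → J → ℝ) (y : Fin M → J → κ → ℝ), (∀ l j, 0 ≤ u l j) ∧
    (∀ l, ∑ j, u l j ≤ w l) ∧ (∀ l j, G j *ᵥ y l j ≤ u l j • (g j - G j *ᵥ ξ l)) ∧
    (∀ k, ∑ l, ∑ j, p k (y l j) ≤ z.1 k) ∧ z.2 ≤ ∑ l, ∑ j, u l j}

variable (p : Fin n → Seminorm ℝ (κ → ℝ)) (w : Fin M → ℝ) (ξ : Fin M → κ → ℝ)
  (G : ∀ j, Matrix (ι j) κ ℝ) (g : ∀ j, ι j → ℝ)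

theorem convex_attainable : Convex ℝ (attainable p w ξ G g) := by
  rintro z ⟨u, y, hu, hw, hG, hp, hv⟩ z' ⟨u', y', hu', hw', hG', hp', hv'⟩ a c ha hc hac
  refine ⟨a • u + c • u', a • y + c • y', fun l j => ?_, fun l => ?_, fun l j => ?_,
    fun k => ?_, ?_⟩
  · exact add_nonneg (mul_nonneg ha (hu l j)) (mul_nonneg hc (hu' l j))
  · simp only [Pi.add_apply, Pi.smul_apply, smul_eq_mul, Finset.sum_add_distrib,
      ← Finset.mul_sum]
    calc a * ∑ j, u l j + c * ∑ j, u' l j ≤ a * w l + c * w l := by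
          gcongr
          · exact hw l
          · exact hw' l
      _ = w l := by rw [← add_mul, hac, one_mul]
  · simp only [Pi.add_apply, Pi.smul_apply, Matrix.mulVec_add, Matrix.mulVec_smul, smul_eq_mul,
      add_smul, mul_smul]
    exact add_le_add (smul_le_smul_of_nonneg_left (hG l j) ha)
      (smul_le_smul_of_nonneg_left (hG' l j) hc)
  · calc ∑ l, ∑ j, p k ((a • y + c • y') l j)
        ≤ ∑ l, ∑ j, (a * p k (y l j) + c * p k (y' l j)) := by
          refine Finset.sum_le_sum fun l _ => Finset.sum_le_sum fun j _ => ?_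
          refine (map_add_le_add (p k) (a • y l j) (c • y' l j)).trans_eq ?_
          rw [map_smul_eq_mul, map_smul_eq_mul, Real.norm_of_nonneg ha, Real.norm_of_nonneg hc]
      _ = a * ∑ l, ∑ j, p k (y l j) + c * ∑ l, ∑ j, p k (y' l j) := by
          simp only [Finset.sum_add_distrib, Finset.mul_sum]
      _ ≤ a * z.1 k + c * z'.1 k := by
          gcongr
          · exact hp k
          · exact hp' k
  · calc a * z.2 + c * z'.2 ≤ a * ∑ l, ∑ j, u l j + c * ∑ l, ∑ j, u' l j := by gcongr
      _ = ∑ l, ∑ j, (a • u + c • u') l j := by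
          simp only [Pi.add_apply, Pi.smul_apply, smul_eq_mul, Finset.sum_add_distrib,
            Finset.mul_sum]

-- Masses are bounded by `w`, and displacements by the costs since the `p k` jointly dominate a
-- norm. A subsequence of the witnesses therefore converges, and all the constraints are closed.
open Filter Topology in
theorem isClosed_attainable (hp : ∀ y, (∀ k, p k y = 0) → y = 0) :
    IsClosed (attainable p w ξ G g) := by
  obtain ⟨c, hc, hle⟩ := exists_pos_mul_norm_le (∑ k, p k) (fun y hy => hp y fun k => by
    simp only [FunLike.coe_sum, Finset.sum_apply] at hy
    exact (Finset.sum_eq_zero_iff_of_nonneg fun k _ => apply_nonneg (p k) y).1 hy k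
      (Finset.mem_univ k))
  refine IsSeqClosed.isClosed fun z z₀ hz hlim => ?_
  choose u y hu hw hG hcost hv using hz
  have hlim1 : ∀ k, Tendsto (fun i => (z i).1 k) atTop (𝓝 (z₀.1 k)) := fun k =>
    (((continuous_apply k).comp continuous_fst).tendsto z₀).comp hlim
  have hlim2 : Tendsto (fun i => (z i).2) atTop (𝓝 z₀.2) :=
    (continuous_snd.tendsto z₀).comp hlim
  obtain ⟨B, hB⟩ := (tendsto_finsetSum Finset.univ fun k _ => hlim1 k).bddAbove_range
  have hB' : ∀ i, ∑ k, (z i).1 k ≤ B := fun i => hB ⟨i, rfl⟩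
  have hy : ∀ i l j, ‖y i l j‖ ≤ |B| / c := fun i l j => by
    rw [le_div_iff₀ hc, mul_comm]
    calc c * ‖y i l j‖ ≤ ∑ k, p k (y i l j) := by
          simpa only [FunLike.coe_sum, Finset.sum_apply] using hle (y i l j)
      _ ≤ ∑ k, (z i).1 k := Finset.sum_le_sum fun k _ => by
          refine le_trans ?_ (hcost i k)
          refine le_trans ?_ (Finset.single_le_sum (f := fun l => ∑ j, p k (y i l j))
            (fun l _ => Finset.sum_nonneg fun j _ => apply_nonneg _ _) (Finset.mem_univ l))
          exact Finset.single_le_sum (f := fun j => p k (y i l j))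
            (fun j _ => apply_nonneg _ _) (Finset.mem_univ j)
      _ ≤ |B| := (hB' i).trans (le_abs_self B)
  have hu' : ∀ i l j, ‖u i l j‖ ≤ ‖w‖ := fun i l j => by
    rw [Real.norm_of_nonneg (hu i l j)]
    refine (Finset.single_le_sum (f := u i l) (fun j _ => hu i l j) (Finset.mem_univ j)).trans ?_
    exact (hw i l).trans ((le_abs_self _).trans (norm_le_pi_norm w l))
  have hbdd : ∀ i, (u i, y i) ∈ Metric.closedBall (0 : (Fin M → J → ℝ) × (Fin M → J → κ → ℝ))
      (‖w‖ + |B| / c) := fun i => by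
    have h0 : 0 ≤ |B| / c := by positivity
    rw [mem_closedBall_zero_iff, Prod.norm_mk]
    refine max_le ?_ ?_
    · refine (pi_norm_le_iff_of_nonneg (by positivity)).2 fun l =>
        (pi_norm_le_iff_of_nonneg (by positivity)).2 fun j => (hu' i l j).trans (by linarith)
    · refine (pi_norm_le_iff_of_nonneg (by positivity)).2 fun l =>
        (pi_norm_le_iff_of_nonneg (by positivity)).2 fun j =>
          (hy i l j).trans (by linarith [norm_nonneg w])
  obtain ⟨⟨u₀, y₀⟩, -, φ, hφ, hlimφ⟩ := tendsto_subseq_of_bounded Metric.isBounded_closedBall hbdd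
  have hlu : ∀ l j, Tendsto (fun i => u (φ i) l j) atTop (𝓝 (u₀ l j)) := fun l j =>
    (Continuous.tendsto (f := fun x : (Fin M → J → ℝ) × (Fin M → J → κ → ℝ) => x.1 l j)
      (by fun_prop) (u₀, y₀)).comp hlimφ
  have hly : ∀ l j, Tendsto (fun i => y (φ i) l j) atTop (𝓝 (y₀ l j)) := fun l j =>
    (Continuous.tendsto (f := fun x : (Fin M → J → ℝ) × (Fin M → J → κ → ℝ) => x.2 l j)
      (by fun_prop) (u₀, y₀)).comp hlimφ
  refine ⟨u₀, y₀, fun l j => ?_, fun l => ?_, fun l j q => ?_, fun k => ?_, ?_⟩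
  · exact ge_of_tendsto' (hlu l j) fun i => hu _ l j
  · exact le_of_tendsto' (tendsto_finsetSum _ fun j _ => hlu l j) fun i => hw _ l
  · refine le_of_tendsto_of_tendsto' (f := fun i => (G j *ᵥ y (φ i) l j) q)
      ((Continuous.tendsto (f := fun x => (G j *ᵥ x) q) (by fun_prop) _).comp (hly l j))
      ((hlu l j).mul_const _) fun i => hG (φ i) l j q
  · exact le_of_tendsto_of_tendsto' (tendsto_finsetSum _ fun l _ => tendsto_finsetSum _ fun j _ =>
      ((continuous_seminorm_pi (p k)).tendsto _).comp (hly l j))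
      ((hlim1 k).comp hφ.tendsto_atTop) fun i => hcost (φ i) k
  · exact le_of_tendsto_of_tendsto' (hlim2.comp hφ.tendsto_atTop)
      (tendsto_finsetSum _ fun l _ => tendsto_finsetSum _ fun j _ => hlu l j) fun i => hv (φ i)

/-- A cost-mass pair that is not attainable is strictly separated from the attainable ones by
nonnegative prices. -/
theorem exists_prices_of_notMem_attainable (hp : ∀ y, (∀ k, p k y = 0) → y = 0)
    (hw : ∀ l, 0 ≤ w l) (ε : Fin n → ℝ) (hε : ∀ k, 0 ≤ ε k) (v : ℝ)
    (hv : (ε, v) ∉ attainable p w ξ G g) :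
    ∃ (lam : Fin n → ℝ) (t : ℝ), 0 ≤ lam ∧ t < v - lam ⬝ᵥ ε ∧
      ∀ z ∈ attainable p w ξ G g, z.2 - lam ⬝ᵥ z.1 ≤ t := by
  have hzero : ∀ e : Fin n → ℝ, (∀ k, 0 ≤ e k) → ∀ t ≤ 0, (e, t) ∈ attainable p w ξ G g :=
    fun e he t ht => ⟨0, 0, by simp, by simpa using hw, by simp, by simpa using he, by simpa using ht⟩
  have hvpos : 0 < v := by
    by_contra h
    exact hv (hzero ε hε v (not_lt.1 h))
  obtain ⟨φ, t, hφ, hφv⟩ := geometric_hahn_banach_closed_point (convex_attainable p w ξ G g)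
    (isClosed_attainable p w ξ G g hp) hv
  set a : Fin n → ℝ := fun k => φ (Pi.single k 1, 0) with ha
  set β := φ (0, 1) with hβ
  have hsplit : ∀ e s, φ (e, s) = a ⬝ᵥ e + s * β := fun e s => by
    have h1 : (e, s) = ∑ k, e k • ((Pi.single k 1 : Fin n → ℝ), (0 : ℝ)) + s • (0, 1) := by
      ext i
      · simp [Prod.fst_sum, Finset.sum_apply, Pi.single_apply]
      · simp [Prod.snd_sum]
    rw [h1, map_add, map_sum, map_smul, smul_eq_mul]
    simp only [map_smul, smul_eq_mul, dotProduct, a, β, mul_comm]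
  -- `(ε, 0)` is attainable by moving nothing, so the separation of `(ε, v)` must use the mass
  -- coordinate.
  have hβpos : 0 < β := by
    have := (hφ _ (hzero ε hε 0 le_rfl)).trans hφv
    rw [hsplit, hsplit] at this
    nlinarith
  -- Costs may be overstated arbitrarily, so a positive `a k` would make `φ` unbounded on the
  -- attainable set.
  have hak : ∀ k, a k ≤ 0 := fun k => by
    by_contra hcon
    push Not at hcon
    have hc : 0 ≤ (|t| + 1) / a k := by positivity
    have := hφ _ (hzero (Pi.single k ((|t| + 1) / a k)) (fun j => by
      rcases eq_or_ne j k with rfl | hj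
      · simpa using hc
      · simp [hj]) 0 le_rfl)
    rw [hsplit, dotProduct_single, mul_div_cancel₀ _ hcon.ne'] at this
    linarith [le_abs_self t]
  have hdot : ∀ e, (fun k => -a k / β) ⬝ᵥ e = -(a ⬝ᵥ e) / β := fun e => by
    simp only [dotProduct, ← Finset.sum_neg_distrib, Finset.sum_div]
    exact Finset.sum_congr rfl fun k _ => by ring
  refine ⟨fun k => -a k / β, t / β, fun k => div_nonneg (neg_nonneg.2 (hak k)) hβpos.le, ?_, ?_⟩
  · rw [hsplit] at hφv
    rw [hdot, div_lt_iff₀ hβpos, sub_mul, div_mul_cancel₀ _ hβpos.ne']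
    linarith
  · intro z hz
    have := hφ z hz
    rw [show z = (z.1, z.2) from rfl, hsplit] at this
    rw [hdot, le_div_iff₀ hβpos, sub_mul, div_mul_cancel₀ _ hβpos.ne']
    linarith

/-- Strong duality in the masses: the prices of a nonattainable pair leave a total
profit smaller than `v`. -/
theorem exists_prices_and_profits (hp : ∀ y, (∀ k, p k y = 0) → y = 0)
    (hw : ∀ l, 0 ≤ w l) (hw1 : ∑ l, w l = 1) (ε : Fin n → ℝ) (hε : ∀ k, 0 ≤ ε k) (v : ℝ)
    (hv : (ε, v) ∉ attainable p w ξ G g) :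
    ∃ (lam : Fin n → ℝ) (s : Fin M → ℝ), 0 ≤ lam ∧ (∀ l, 0 ≤ s l) ∧
      lam ⬝ᵥ ε + ∑ l, w l * s l ≤ v ∧
      ∀ l j, ∀ x ∈ polyhedron (G j) (g j), 1 ≤ s l + ∑ k, lam k * p k (x - ξ l) := by
  classical
  obtain ⟨lam, t, hlam, ht, hsep⟩ := exists_prices_of_notMem_attainable p w ξ G g hp hw ε hε v hv
  -- Unit profits of the atom `l`: stay put and earn `0`, or reach a target and earn `1` minus the
  -- priced cost.
  let V : Fin M → Set ℝ := fun l => {c | c = 0 ∨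
    ∃ j, ∃ x ∈ polyhedron (G j) (g j), c = 1 - ∑ k, lam k * p k (x - ξ l)}
  have hVne : ∀ l, (V l).Nonempty := fun l => ⟨0, Or.inl rfl⟩
  have hVbdd : ∀ l, BddAbove (V l) := fun l => ⟨1, by
    rintro c (rfl | ⟨j, x, -, rfl⟩)
    · exact zero_le_one
    · exact sub_le_self _ (Finset.sum_nonneg fun k _ => mul_nonneg (hlam k) (apply_nonneg _ _))⟩
  have hmove : ∀ l, ∀ c ∈ V l, ∃ (u : J → ℝ) (y : J → κ → ℝ), (∀ j, 0 ≤ u j) ∧ ∑ j, u j ≤ w l ∧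
      (∀ j, G j *ᵥ y j ≤ u j • (g j - G j *ᵥ ξ l)) ∧
      ∑ j, u j - ∑ k, lam k * ∑ j, p k (y j) = w l * c := by
    rintro l c (rfl | ⟨j, x, hx, rfl⟩)
    · exact ⟨0, 0, by simp, by simpa using hw l, by simp, by simp⟩
    · refine ⟨Pi.single j (w l), Pi.single j (w l • (x - ξ l)), fun i => ?_, ?_, fun i => ?_, ?_⟩
      · rcases eq_or_ne i j with rfl | h
        · simpa using hw l
        · simp [h]
      · simp
      · rcases eq_or_ne i j with rfl | h
        · simp only [Pi.single_eq_same, Matrix.mulVec_smul, Matrix.mulVec_sub]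
          exact smul_le_smul_of_nonneg_left (sub_le_sub_right hx _) (hw l)
        · simp [h]
      · have : ∀ k, ∑ i, p k ((Pi.single j (w l • (x - ξ l)) : J → κ → ℝ) i)
            = w l * p k (x - ξ l) := fun k => by
          rw [Finset.sum_eq_single j (fun i _ hi => by simp [hi]) (by simp), Pi.single_eq_same,
            map_smul_eq_mul, Real.norm_of_nonneg (hw l)]
        simp only [this, Finset.sum_pi_single', Finset.mem_univ, if_true, mul_sub, mul_one,
          Finset.mul_sum]
        exact congrArg _ (Finset.sum_congr rfl fun k _ => by ring)
  -- The suprema need not be attained. An error of `v - lam ⬝ᵥ ε - t` per unit of mass is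
  -- affordable, because the weights sum to one.
  choose c hcV hc using fun l => exists_lt_of_lt_csSup (hVne l)
    (sub_lt_self (sSup (V l)) (sub_pos.2 ht))
  choose u y hu huw hG hval using fun l => hmove l (c l) (hcV l)
  have hatt := hsep (fun k => ∑ l, ∑ j, p k (y l j), ∑ l, ∑ j, u l j)
    ⟨u, y, hu, huw, hG, fun _ => le_rfl, le_rfl⟩
  refine ⟨lam, fun l => sSup (V l), hlam, fun l => le_csSup (hVbdd l) (Or.inl rfl), ?_,
    fun l j x hx => ?_⟩
  · have h1 : ∑ l, w l * c l ≤ t := by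
      refine le_trans (le_of_eq ?_) hatt
      simp only [← hval, Finset.sum_sub_distrib, dotProduct, Finset.mul_sum]
      exact congrArg _ Finset.sum_comm
    have h2 : ∑ l, w l * sSup (V l) ≤ ∑ l, (w l * c l + w l * (v - lam ⬝ᵥ ε - t)) :=
      Finset.sum_le_sum fun l _ => by
        rw [← mul_add]
        exact mul_le_mul_of_nonneg_left (by linarith [hc l]) (hw l)
    rw [Finset.sum_add_distrib, ← Finset.sum_mul, hw1, one_mul] at h2
    linarith
  · have := le_csSup (hVbdd l) (Or.inr ⟨j, x, hx, rfl⟩)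
    linarith

end Attainable

/-! ### Transport plans: lower and upper bounds on the worst case -/

section Transport

variable {n : ℕ} {d : Fin n → ℕ} {M : ℕ}

/-- Splitting the mass of each atom `ξ l` over the points `x l o` of `Ξ` gives an element of the
multi-transport hyperrectangle if the transport costs are within the budgets. -/
theorem sum_dirac_mem_transportHyperrectangle {O : Type*} [Fintype O]
    (N : ∀ k, Seminorm ℝ (Fin (d k) → ℝ)) (Ξ : Set (BlockSpace d)) (ξ : Fin M → BlockSpace d)
    (hξ : ∀ l, ξ l ∈ Ξ) (ϑ : Fin M → ℝ) (hϑ : ∑ l, ϑ l = 1) (ε : Fin n → ℝ)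
    (m : Fin M → O → ℝ) (x : Fin M → O → BlockSpace d) (hm : ∀ l o, 0 ≤ m l o)
    (hsum : ∀ l, ∑ o, m l o = ϑ l) (hx : ∀ l o, x l o ∈ Ξ)
    (hcost : ∀ k, ∑ l, ∑ o, m l o * blockSeminorm N k (ξ l - x l o) ≤ ε k) :
    ∑ l, ∑ o, ENNReal.ofReal (m l o) • Measure.dirac (x l o) ∈
      transportHyperrectangle N Ξ (discreteMeasure ϑ ξ) ε := by
  have hsum' : ∀ l, ∑ o, ENNReal.ofReal (m l o) = ENNReal.ofReal (ϑ l) := fun l => by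
    rw [← hsum l, ENNReal.ofReal_sum_of_nonneg fun o _ => hm l o]
  refine ⟨∑ l, ∑ o, ENNReal.ofReal (m l o) • Measure.dirac (ξ l, x l o), ⟨?_⟩, ?_, ?_, ?_, ?_⟩
  · simp only [Measure.finsetSum_apply, Measure.smul_apply, measure_univ, smul_eq_mul, mul_one,
      hsum']
    rw [← ENNReal.ofReal_sum_of_nonneg, hϑ, ENNReal.ofReal_one]
    exact fun l _ => hsum l ▸ Finset.sum_nonneg fun o _ => hm l o
  · simp [Measure.finsetSum_apply, hξ, hx]
  · ext s hs
    rw [Measure.map_apply measurable_fst hs]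
    simp only [discreteMeasure, Measure.finsetSum_apply, Measure.smul_apply,
      Measure.dirac_apply' _ (measurable_fst hs), Measure.dirac_apply' _ hs, smul_eq_mul]
    refine Finset.sum_congr rfl fun l _ => ?_
    rw [← hsum', Finset.sum_mul]
    rfl
  · intro k
    simp only [lintegral_finsetSum_measure, lintegral_smul_measure, lintegral_dirac, smul_eq_mul]
    refine le_trans (le_of_eq ?_) (ENNReal.ofReal_le_ofReal (hcost k))
    rw [ENNReal.ofReal_sum_of_nonneg fun l _ => Finset.sum_nonneg fun o _ =>
      mul_nonneg (hm l o) (apply_nonneg _ _)]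
    refine Finset.sum_congr rfl fun l _ => ?_
    rw [ENNReal.ofReal_sum_of_nonneg fun o _ => mul_nonneg (hm l o) (apply_nonneg _ _)]
    exact Finset.sum_congr rfl fun o _ => (ENNReal.ofReal_mul (hm l o)).symm
  · ext s hs
    rw [Measure.map_apply measurable_snd hs]
    simp only [Measure.finsetSum_apply, Measure.smul_apply,
      Measure.dirac_apply' _ (measurable_snd hs), Measure.dirac_apply' _ hs, smul_eq_mul]
    rfl

/-- An attainable mass bounds the worst-case probability from below. -/
theorem le_worstCaseProb_of_mem_attainable {J : Type*} [Fintype J] {ι : J → Type*}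
    (N : ∀ k, Seminorm ℝ (Fin (d k) → ℝ)) (Ξ : Set (BlockSpace d)) (ξ : Fin M → BlockSpace d)
    (hξ : ∀ l, ξ l ∈ Ξ) (ϑ : Fin M → ℝ) (hϑ : ∑ l, ϑ l = 1) (ε : Fin n → ℝ)
    (G : ∀ j, Matrix (ι j) ((k : Fin n) × Fin (d k)) ℝ) (g : ∀ j, ι j → ℝ)
    (S : Set (BlockSpace d)) (hGS : ∀ j, polyhedron (G j) (g j) ⊆ S ∩ Ξ) (v : ℝ)
    (hv : (ε, v) ∈ attainable (blockSeminorm N) ϑ ξ G g) :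
    (v : EReal) ≤ worstCaseProb (transportHyperrectangle N Ξ (discreteMeasure ϑ ξ) ε) S := by
  obtain ⟨u, y, hu, huϑ, hG, hcost, hle⟩ := hv
  have hpoly : ∀ l j, 0 < u l j → ξ l + (u l j)⁻¹ • y l j ∈ polyhedron (G j) (g j) := by
    intro l j hpos i
    have := hG l j i
    simp only [Pi.smul_apply, Pi.sub_apply, smul_eq_mul] at this
    rw [← inv_mul_le_iff₀ hpos] at this
    rw [Matrix.mulVec_add, Matrix.mulVec_smul]
    simp only [Pi.add_apply, Pi.smul_apply, smul_eq_mul]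
    linarith
  let m : Fin M → Option J → ℝ := fun l o => o.elim (ϑ l - ∑ j, u l j) (u l)
  -- `none` is the mass that stays. As `0⁻¹ = 0`, a piece with `u l j = 0` sits at `ξ l`; its
  -- displacement, possibly a nonzero recession direction, is dropped, which can only lower the
  -- cost.
  let x : Fin M → Option J → BlockSpace d := fun l o =>
    o.elim (ξ l) fun j => ξ l + (u l j)⁻¹ • y l j
  have hm : ∀ l o, 0 ≤ m l o := by
    rintro l (_ | j)
    · exact sub_nonneg.2 (huϑ l)
    · exact hu l j
  have hP := sum_dirac_mem_transportHyperrectangle N Ξ ξ hξ ϑ hϑ ε m x hm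
    (fun l => by simp [m, Fintype.sum_option])
    (by
      rintro l (_ | j)
      · exact hξ l
      · rcases (hu l j).eq_or_lt with h0 | hpos
        · simpa [x, ← h0] using hξ l
        · exact (hGS j (hpoly l j hpos)).2)
    (fun k => by
      refine le_trans (Finset.sum_le_sum fun l _ => ?_) (hcost k)
      rw [Fintype.sum_option]
      simp only [x, m, Option.elim, sub_self, map_zero, mul_zero, zero_add]
      refine Finset.sum_le_sum fun j _ => ?_
      rcases (hu l j).eq_or_lt with h0 | hpos
      · rw [← h0, zero_mul]
        exact apply_nonneg _ _
      · rw [sub_add_cancel_left, map_neg_eq_map, map_smul_eq_mul,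
          Real.norm_of_nonneg (inv_nonneg.2 hpos.le), mul_inv_cancel_left₀ hpos.ne'])
  refine le_trans (EReal.coe_le_coe_iff.2 ?_) (le_iSup₂ (f := fun (P : Measure (BlockSpace d)) _ =>
    ((P.real S : ℝ) : EReal)) _ hP)
  refine hle.trans ?_
  have hfin : (∑ l, ∑ o, ENNReal.ofReal (m l o) • Measure.dirac (x l o)) S ≠ ⊤ := by
    simp only [Measure.finsetSum_apply, Measure.smul_apply, smul_eq_mul]
    exact ENNReal.sum_ne_top.2 fun l _ => ENNReal.sum_ne_top.2 fun o _ =>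
      ENNReal.mul_ne_top ENNReal.ofReal_ne_top (measure_ne_top _ _)
  rw [Measure.real, ← ENNReal.ofReal_le_iff_le_toReal hfin,
    ENNReal.ofReal_sum_of_nonneg fun l _ => Finset.sum_nonneg fun j _ => hu l j]
  simp only [Measure.finsetSum_apply, Measure.smul_apply, smul_eq_mul]
  refine Finset.sum_le_sum fun l _ => ?_
  rw [ENNReal.ofReal_sum_of_nonneg fun j _ => hu l j, Fintype.sum_option]
  refine le_trans (Finset.sum_le_sum fun j _ => ?_) le_add_self
  rcases (hu l j).eq_or_lt with h0 | hpos
  · simp [← h0]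
  · have : x l (some j) ∈ S := (hGS j (hpoly l j hpos)).1
    simp [m, this]

/-- Feasible prices and profits bound the worst-case probability from above. -/
theorem worstCaseProb_le_of_prices
    (N : ∀ k, Seminorm ℝ (Fin (d k) → ℝ)) (Ξ : Set (BlockSpace d)) (ξ : Fin M → BlockSpace d)
    (ϑ : Fin M → ℝ) (hϑ : ∀ l, 0 ≤ ϑ l) (ε : Fin n → ℝ) (hε : ∀ k, 0 ≤ ε k)
    (S : Set (BlockSpace d)) (hS : MeasurableSet S) (lam : Fin n → ℝ) (s : Fin M → ℝ)
    (hlam : 0 ≤ lam) (hs : ∀ l, 0 ≤ s l)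
    (h : ∀ l, ∀ x ∈ S ∩ Ξ, 1 ≤ s l + ∑ k, lam k * blockSeminorm N k (ξ l - x)) :
    worstCaseProb (transportHyperrectangle N Ξ (discreteMeasure ϑ ξ) ε) S ≤
      ((lam ⬝ᵥ ε + ∑ l, ϑ l * s l : ℝ) : EReal) := by
  classical
  refine iSup₂_le fun P hP => EReal.coe_le_coe_iff.2 ?_
  obtain ⟨π, hπ, hnull, hfst, hcost, rfl⟩ := hP
  -- The value `⊤` off the atoms makes the pointwise bound trivial there and costs nothing, as `Q`
  -- lives on the atoms. The infimum allows for repeated atoms.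
  let T : BlockSpace d → ℝ≥0∞ := fun ζ => ⨅ l, if ξ l = ζ then ENNReal.ofReal (s l) else ⊤
  have hT : Measurable T := Measurable.iInf fun l =>
    Measurable.ite (measurableSet_eq_fun measurable_const measurable_id) measurable_const
      measurable_const
  have hT' : Measurable fun z : BlockSpace d × BlockSpace d => T z.1 := hT.comp measurable_fst
  have hcostm : ∀ k, Measurable fun z : BlockSpace d × BlockSpace d =>
      ENNReal.ofReal (blockSeminorm N k (z.1 - z.2)) := fun k =>
    ((continuous_seminorm_pi (blockSeminorm N k)).measurable.comp
      (measurable_fst.sub measurable_snd)).ennreal_ofReal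
  have hpt : ∀ᵐ z ∂π, (Prod.snd ⁻¹' S).indicator (fun _ => (1 : ℝ≥0∞)) z ≤
      T z.1 + ∑ k, ENNReal.ofReal (lam k) * ENNReal.ofReal (blockSeminorm N k (z.1 - z.2)) := by
    filter_upwards [measure_eq_zero_iff_ae_notMem.1 hnull] with z hz
    rw [Set.notMem_compl_iff] at hz
    by_cases hzS : z ∈ Prod.snd ⁻¹' S
    swap
    · rw [Set.indicator_of_notMem hzS]
      exact zero_le
    rw [Set.indicator_of_mem hzS, ENNReal.iInf_add]
    refine le_iInf fun l => ?_
    split_ifs with hl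
    · rw [← hl]
      calc (1 : ℝ≥0∞) = ENNReal.ofReal 1 := ENNReal.ofReal_one.symm
        _ ≤ ENNReal.ofReal (s l + ∑ k, lam k * blockSeminorm N k (ξ l - z.2)) :=
          ENNReal.ofReal_le_ofReal (h l z.2 ⟨hzS, hz.2⟩)
        _ = _ := by
          have h0 : ∀ k ∈ Finset.univ, 0 ≤ lam k * blockSeminorm N k (ξ l - z.2) :=
            fun k _ => mul_nonneg (hlam k) (apply_nonneg _ _)
          rw [ENNReal.ofReal_add (hs l) (Finset.sum_nonneg h0), ENNReal.ofReal_sum_of_nonneg h0]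
          exact congrArg _ (Finset.sum_congr rfl fun k _ => ENNReal.ofReal_mul (hlam k))
    · simp
  have hTint : ∫⁻ z, T z.1 ∂π ≤ ∑ l, ENNReal.ofReal (ϑ l) * ENNReal.ofReal (s l) := by
    rw [← lintegral_map hT measurable_fst, hfst, discreteMeasure]
    simp only [lintegral_finsetSum_measure, lintegral_smul_measure, lintegral_dirac, smul_eq_mul]
    exact Finset.sum_le_sum fun l _ => mul_le_mul_right ((iInf_le _ l).trans_eq (by simp)) _
  have hobj : 0 ≤ lam ⬝ᵥ ε + ∑ l, ϑ l * s l :=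
    add_nonneg (dotProduct_nonneg_of_nonneg hlam hε)
      (Finset.sum_nonneg fun l _ => mul_nonneg (hϑ l) (hs l))
  refine ENNReal.toReal_le_of_le_ofReal hobj ?_
  rw [Measure.map_apply measurable_snd hS]
  calc π (Prod.snd ⁻¹' S)
      = ∫⁻ z, (Prod.snd ⁻¹' S).indicator (fun _ => (1 : ℝ≥0∞)) z ∂π :=
        (lintegral_indicator_one (measurable_snd hS)).symm
    _ ≤ ∫⁻ z, T z.1 + ∑ k, ENNReal.ofReal (lam k) *
          ENNReal.ofReal (blockSeminorm N k (z.1 - z.2)) ∂π := lintegral_mono_ae hpt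
    _ = ∫⁻ z, T z.1 ∂π + ∑ k, ENNReal.ofReal (lam k) *
          ∫⁻ z, ENNReal.ofReal (blockSeminorm N k (z.1 - z.2)) ∂π := by
        rw [lintegral_add_left hT',
          lintegral_finsetSum _ fun k _ => (hcostm k).const_mul _]
        simp only [lintegral_const_mul _ (hcostm _)]
    _ ≤ ∑ l, ENNReal.ofReal (ϑ l) * ENNReal.ofReal (s l) +
          ∑ k, ENNReal.ofReal (lam k) * ENNReal.ofReal (ε k) :=
        add_le_add hTint (Finset.sum_le_sum fun k _ => mul_le_mul_right (hcost k) _)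
    _ = ENNReal.ofReal (lam ⬝ᵥ ε + ∑ l, ϑ l * s l) := by
        rw [ENNReal.ofReal_add (dotProduct_nonneg_of_nonneg hlam hε)
          (Finset.sum_nonneg fun l _ => mul_nonneg (hϑ l) (hs l)), dotProduct,
          ENNReal.ofReal_sum_of_nonneg fun k _ => mul_nonneg (hlam k) (hε k),
          ENNReal.ofReal_sum_of_nonneg fun l _ => mul_nonneg (hϑ l) (hs l), add_comm]
        congr 1
        · exact Finset.sum_congr rfl fun k _ => (ENNReal.ofReal_mul (hlam k)).symm
        · exact Finset.sum_congr rfl fun l _ => (ENNReal.ofReal_mul (hϑ l)).symm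

end Transport

/-! ### The dual program and strong duality -/

section Duality

variable {n : ℕ} {d : Fin n → ℕ} {M r : ℕ} {J : Type} {R : J → Type} [∀ j, Fintype (R j)]

/-- The feasible set of the dual program for finitely many polyhedra `{x : A j x ⪯ b j}`, with
sign constraints on all the prices. -/
def dualFeasible (N : ∀ k, Seminorm ℝ (Fin (d k) → ℝ))
    (C : Matrix (Fin r) ((k : Fin n) × Fin (d k)) ℝ) (f : Fin r → ℝ)
    (ξ : Fin M → BlockSpace d)
    (A : ∀ j, Matrix (R j) ((k : Fin n) × Fin (d k)) ℝ) (b : ∀ j, R j → ℝ) :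
    Set (Variables n M r J R) :=
  {(lam, s, θ, γ) |
    (∀ l j, 1 + θ l j ⬝ᵥ (b j - A j *ᵥ ξ l) + γ l j ⬝ᵥ (f - C *ᵥ ξ l) ≤ s l) ∧
    (∀ l j k, dualNorm (N k) (pr k ((A j)ᵀ *ᵥ θ l j + Cᵀ *ᵥ γ l j)) ≤ lam k) ∧
    (∀ l j, 0 ≤ γ l j) ∧ (∀ l j, 0 ≤ θ l j) ∧ (∀ l, 0 ≤ s l) ∧ 0 ≤ lam}

variable (N : ∀ k, Seminorm ℝ (Fin (d k) → ℝ))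
  (C : Matrix (Fin r) ((k : Fin n) × Fin (d k)) ℝ) (f : Fin r → ℝ) (ξ : Fin M → BlockSpace d)
  (A : ∀ j, Matrix (R j) ((k : Fin n) × Fin (d k)) ℝ) (b : ∀ j, R j → ℝ)

theorem convex_dualFeasible (hN : ∀ k x, N k x = 0 → x = 0) : Convex ℝ (dualFeasible N C f ξ A b) := by
  rintro ⟨lam, s, θ, γ⟩ ⟨h1, h2, h3, h4, h5, h6⟩ ⟨lam', s', θ', γ'⟩
    ⟨h1', h2', h3', h4', h5', h6'⟩ t t' ht ht' htt
  have key : ∀ l j, (A j)ᵀ *ᵥ (t • θ l j + t' • θ' l j) + Cᵀ *ᵥ (t • γ l j + t' • γ' l j)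
      = t • ((A j)ᵀ *ᵥ θ l j + Cᵀ *ᵥ γ l j) + t' • ((A j)ᵀ *ᵥ θ' l j + Cᵀ *ᵥ γ' l j) := by
    intro l j
    simp only [Matrix.mulVec_add, Matrix.mulVec_smul, smul_add]
    abel
  change (t • lam + t' • lam', t • s + t' • s', t • θ + t' • θ', t • γ + t' • γ') ∈ _
  refine ⟨fun l j => ?_, fun l j k => ?_, fun l j => ?_, fun l j => ?_, fun l => ?_, ?_⟩
  · have e := add_le_add (mul_le_mul_of_nonneg_left (h1 l j) ht)
      (mul_le_mul_of_nonneg_left (h1' l j) ht')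
    simp only [Pi.add_apply, Pi.smul_apply, smul_eq_mul, add_dotProduct, smul_dotProduct]
    linarith
  · simp only [Pi.add_apply, Pi.smul_apply, key]
    obtain ⟨h0, hx⟩ := (dualNorm_le_iff _ (hN k) _ _).1 (h2 l j k)
    obtain ⟨h0', hx'⟩ := (dualNorm_le_iff _ (hN k) _ _).1 (h2' l j k)
    refine (dualNorm_le_iff _ (hN k) _ _).2 ⟨add_nonneg (mul_nonneg ht h0) (mul_nonneg ht' h0'), fun x => ?_⟩
    have e := add_le_add (mul_le_mul_of_nonneg_left (hx x) ht)
      (mul_le_mul_of_nonneg_left (hx' x) ht')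
    change (t • pr k ((A j)ᵀ *ᵥ θ l j + Cᵀ *ᵥ γ l j)
      + t' • pr k ((A j)ᵀ *ᵥ θ' l j + Cᵀ *ᵥ γ' l j)) ⬝ᵥ x ≤ (t * lam k + t' * lam' k) * N k x
    simp only [add_dotProduct, smul_dotProduct, smul_eq_mul]
    linarith
  · exact add_nonneg (smul_nonneg ht (h3 l j)) (smul_nonneg ht' (h3' l j))
  · exact add_nonneg (smul_nonneg ht (h4 l j)) (smul_nonneg ht' (h4' l j))
  · exact add_nonneg (smul_nonneg ht (h5 l)) (smul_nonneg ht' (h5' l))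
  · exact add_nonneg (smul_nonneg ht h6) (smul_nonneg ht' h6')

theorem convexOn_objective_dualFeasible (hN : ∀ k x, N k x = 0 → x = 0) (ε : Fin n → ℝ) (ϑ : Fin M → ℝ) :
    ConvexOn ℝ (dualFeasible N C f ξ A b) (objective ε ϑ) := by
  refine ⟨convex_dualFeasible N C f ξ A b hN, fun x _ y _ t t' _ _ _ => le_of_eq ?_⟩
  simp only [objective, Prod.fst_add, Prod.smul_fst, Prod.snd_add, Prod.smul_snd, add_dotProduct,
    smul_dotProduct, Pi.add_apply, Pi.smul_apply, smul_eq_mul, mul_add, Finset.sum_add_distrib,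
    Finset.mul_sum, mul_left_comm _ t, mul_left_comm _ t']
  ring

/-- **Strong duality** for the worst-case probability of a set that agrees on `Ξ` with a finite
union of polyhedra. -/
theorem worstCaseProb_eq_programValue [Fintype J] (hN : ∀ k x, N k x = 0 → x = 0)
    (hξ : ∀ l, ξ l ∈ polyhedron C f) (ϑ : Fin M → ℝ) (hϑ : ∀ l, 0 ≤ ϑ l)
    (hϑ_sum : ∑ l, ϑ l = 1) (ε : Fin n → ℝ) (hε : ∀ k, 0 ≤ ε k)
    (hne : ∀ j, (polyhedron (A j) (b j) ∩ polyhedron C f).Nonempty)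
    (S : Set (BlockSpace d)) (hS : MeasurableSet S)
    (hSA : S ∩ polyhedron C f = (⋃ j, polyhedron (A j) (b j)) ∩ polyhedron C f) :
    worstCaseProb (transportHyperrectangle N (polyhedron C f) (discreteMeasure ϑ ξ) ε) S =
      programValue (dualFeasible N C f ξ A b) (objective ε ϑ) := by
  refine le_antisymm (le_iInf₂ ?_) (le_of_forall_gt fun c hc => ?_)
  · rintro ⟨lam, s, θ, γ⟩ ⟨h1, h2, h3, h4, h5, h6⟩
    refine worstCaseProb_le_of_prices N _ ξ ϑ hϑ ε hε S hS lam s h6 h5 fun l x hx => ?_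
    rw [hSA] at hx
    obtain ⟨j, hj⟩ := Set.mem_iUnion.1 hx.1
    exact one_le_of_multipliers N hN (A j) (b j) C f (ξ l) lam (s l) (θ l j) (γ l j) (h1 l j)
      (h2 l j) (h3 l j) (h4 l j) x hj hx.2
  · obtain ⟨v, hv, hvc⟩ := EReal.lt_iff_exists_real_btwn.1 hc
    refine lt_of_le_of_lt ?_ hvc
    obtain ⟨lam, s, hlam, hs, hobj, hprofit⟩ := exists_prices_and_profits (blockSeminorm N) ϑ ξ
      (fun j => Matrix.fromRows (A j) C) (fun j => Sum.elim (b j) f)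
      (fun y hy => by
        ext ⟨k, i⟩
        exact congrFun (hN k (pr k y) (hy k)) i)
      hϑ hϑ_sum ε hε v (fun hatt => not_le.2 hv
        (le_worstCaseProb_of_mem_attainable N _ ξ hξ ϑ hϑ_sum ε _ _ S (fun j => by
          rw [polyhedron_fromRows, hSA]
          exact Set.inter_subset_inter_left _ (Set.subset_iUnion_of_subset j subset_rfl)) v hatt))
    choose θ γ hθ hγ h1 h2 using fun l j => exists_multipliers_of_one_le N hN (A j) (b j) C f
      (hne j) (ξ l) lam hlam (s l) (fun x hx => by
        have := hprofit l j x (by rwa [polyhedron_fromRows])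
        simpa only [map_sub_rev] using this)
    exact (iInf₂_le (f := fun (x : Variables n M r J R) _ => ((objective ε ϑ x : ℝ) : EReal))
      (lam, s, θ, γ) ⟨h1, h2, hγ, hθ, hs, hlam⟩).trans (EReal.coe_le_coe_iff.2 hobj)

end Duality

/-! ### Specialization to unions and to complements -/

theorem measurableSet_polyhedron {ι κ : Type*} [Fintype κ] [Countable ι] (A : Matrix ι κ ℝ)
    (b : ι → ℝ) : MeasurableSet (polyhedron A b) := by
  have : IsClosed (polyhedron A b) := isClosed_le (by fun_prop) continuous_const
  exact this.measurableSet

section Specializations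

variable {n : ℕ} {d : Fin n → ℕ} {M r m : ℕ}
  (N : ∀ k, Seminorm ℝ (Fin (d k) → ℝ))
  (C : Matrix (Fin r) ((k : Fin n) × Fin (d k)) ℝ) (f : Fin r → ℝ) (ξ : Fin M → BlockSpace d)

/-- Dual norms are nonnegative, so a single pair `(l₀, j₀)` already forces `0 ≤ lam`. -/
theorem unionFeasible_eq_dualFeasible (hN : ∀ k x, N k x = 0 → x = 0) (l₀ : Fin M) (j₀ : Fin m)
    {ρ : Fin m → ℕ}
    (A : ∀ j, Matrix (Fin (ρ j)) ((k : Fin n) × Fin (d k)) ℝ) (b : ∀ j, Fin (ρ j) → ℝ) :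
    unionFeasible N C f ξ A b = dualFeasible N C f ξ A b := by
  ext ⟨lam, s, θ, γ⟩
  refine ⟨fun ⟨h1, h2, h3, h4, h5⟩ => ⟨h1, h2, h3, h4, h5, fun k => ?_⟩,
    fun ⟨h1, h2, h3, h4, h5, _⟩ => ⟨h1, h2, h3, h4, h5⟩⟩
  exact ((dualNorm_le_iff _ (hN k) _ _).1 (h2 l₀ j₀ k)).1

theorem complementFeasible_eq_dualFeasible {α : Fin m → ℕ}
    (a : ∀ j, Fin (α j) → BlockSpace d) (b : ∀ j, Fin (α j) → ℝ) :
    complementFeasible N C f ξ a b = dualFeasible (R := fun _ => Fin m) N C f ξ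
      (fun q : Selection (polyhedron C f) a b => -selectRows a q.1)
      (fun q => -selectEntries b q.1) := by
  ext ⟨lam, s, θ, γ⟩
  have e1 : ∀ l (q : Selection (polyhedron C f) a b),
      1 + θ l q ⬝ᵥ (-selectEntries b q.1 - -selectRows a q.1 *ᵥ ξ l)
        = 1 - θ l q ⬝ᵥ (selectEntries b q.1 - selectRows a q.1 *ᵥ ξ l) := fun l q => by
    rw [Matrix.neg_mulVec, ← neg_sub', dotProduct_neg, ← sub_eq_add_neg]
  have e2 : ∀ l (q : Selection (polyhedron C f) a b),
      (-selectRows a q.1)ᵀ *ᵥ θ l q + Cᵀ *ᵥ γ l q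
        = Cᵀ *ᵥ γ l q - (selectRows a q.1)ᵀ *ᵥ θ l q := fun l q => by
    rw [Matrix.transpose_neg, Matrix.neg_mulVec, neg_add_eq_sub]
  change _ ↔ (∀ l q, 1 + θ l q ⬝ᵥ (-selectEntries b q.1 - -selectRows a q.1 *ᵥ ξ l)
      + γ l q ⬝ᵥ (f - C *ᵥ ξ l) ≤ s l) ∧
    (∀ l q k, dualNorm (N k) (pr k ((-selectRows a q.1)ᵀ *ᵥ θ l q + Cᵀ *ᵥ γ l q)) ≤ lam k) ∧ _
  simp only [e1, e2]
  rfl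

end Specializations

theorem mem_polyhedron_neg_iff {κ : Type*} [Fintype κ] {m : ℕ} {α : Fin m → ℕ}
    (a : ∀ j, Fin (α j) → κ → ℝ) (b : ∀ j, Fin (α j) → ℝ) (q : ∀ j, Fin (α j)) (x : κ → ℝ) :
    x ∈ polyhedron (-selectRows a q) (-selectEntries b q) ↔
      selectEntries b q ≤ selectRows a q *ᵥ x := by
  simp only [polyhedron, Set.mem_ofPred_eq, Matrix.neg_mulVec, neg_le_neg_iff]

/-- On `Ξ`, the complement of a union of open polyhedra is a union of closed polyhedra. -/
theorem compl_iUnion_inter_eq {κ : Type*} [Fintype κ] {m : ℕ} {α : Fin m → ℕ} (Ξ : Set (κ → ℝ))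
    (a : ∀ j, Fin (α j) → κ → ℝ) (b : ∀ j, Fin (α j) → ℝ) :
    (⋃ j, {x | ∀ i, a j i ⬝ᵥ x < b j i})ᶜ ∩ Ξ =
      (⋃ q : Selection Ξ a b, polyhedron (-selectRows a q.1) (-selectEntries b q.1)) ∩ Ξ := by
  ext x
  simp only [Set.mem_inter_iff, Set.mem_compl_iff, Set.mem_iUnion, Set.mem_ofPred_eq, not_exists,
    not_forall, not_lt, mem_polyhedron_neg_iff]
  refine and_congr_left fun hx => ⟨fun h => ?_, fun ⟨q, hq⟩ j => ⟨q.1 j, hq j⟩⟩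
  -- `q` picks one violated inequality per `j`; the point `x` itself witnesses that this `q` is
  -- selected.
  choose q hq using h
  exact ⟨⟨q, x, hq, hx⟩, hq⟩

theorem measurableSet_compl_iUnion {κ : Type*} [Fintype κ] {m : ℕ} {α : Fin m → ℕ}
    (a : ∀ j, Fin (α j) → κ → ℝ) (b : ∀ j, Fin (α j) → ℝ) :
    MeasurableSet (⋃ j, {x : κ → ℝ | ∀ i, a j i ⬝ᵥ x < b j i})ᶜ := by
  refine (IsOpen.measurableSet (isOpen_iUnion fun j => ?_)).compl
  simp only [Set.ofPred_forall]
  exact isOpen_iInter_of_finite fun i =>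
    isOpen_lt (continuous_const.dotProduct continuous_id) continuous_const

end MTH

end

theorem mainTheorem7 {n : ℕ} (d : Fin n → ℕ)
    -- a norm on each block
    (N : ∀ k, Seminorm ℝ (Fin (d k) → ℝ)) (hN : ∀ k x, N k x = 0 → x = 0)
    -- the polyhedral set `Ξ = {x : C x ⪯ f}`
    {r : ℕ} (C : Matrix (Fin r) ((k : Fin n) × Fin (d k)) ℝ) (f : Fin r → ℝ)
    -- the discrete reference distribution on `Ξ`
    {M : ℕ} (ξ : Fin M → MTH.BlockSpace d) (hξ : ∀ l, ξ l ∈ MTH.polyhedron C f)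
    (ϑ : Fin M → ℝ) (hϑ : ∀ l, 0 ≤ ϑ l) (hϑ_sum : ∑ l, ϑ l = 1)
    -- the transport budgets
    (ε : Fin n → ℝ) (hε : ∀ k, 0 ≤ ε k) :
    -- unions of polyhedra
    (∀ (m : ℕ) (_ : 0 < m) (ρ : Fin m → ℕ)
      (A : ∀ j, Matrix (Fin (ρ j)) ((k : Fin n) × Fin (d k)) ℝ) (b : ∀ j, Fin (ρ j) → ℝ),
      (∀ j, (MTH.polyhedron (A j) (b j) ∩ MTH.polyhedron C f).Nonempty) →
      ConvexOn ℝ (MTH.unionFeasible N C f ξ A b) (MTH.objective ε ϑ) ∧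
      MTH.worstCaseProb
          (MTH.transportHyperrectangle N (MTH.polyhedron C f) (MTH.discreteMeasure ϑ ξ) ε)
          (⋃ j, MTH.polyhedron (A j) (b j)) =
        MTH.programValue (MTH.unionFeasible N C f ξ A b) (MTH.objective ε ϑ)) ∧
    -- complements of unions of open polyhedra
    (∀ (m : ℕ) (α : Fin m → ℕ)
      (a : ∀ j, Fin (α j) → MTH.BlockSpace d) (b : ∀ j, Fin (α j) → ℝ),
      ConvexOn ℝ (MTH.complementFeasible N C f ξ a b) (MTH.objective ε ϑ) ∧
      MTH.worstCaseProb
          (MTH.transportHyperrectangle N (MTH.polyhedron C f) (MTH.discreteMeasure ϑ ξ) ε)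
          (⋃ j, {x | ∀ i, a j i ⬝ᵥ x < b j i})ᶜ =
        MTH.programValue (MTH.complementFeasible N C f ξ a b) (MTH.objective ε ϑ)) := by
  obtain ⟨l₀⟩ : Nonempty (Fin M) := by
    by_contra h
    rw [not_nonempty_iff] at h
    simp at hϑ_sum
  refine ⟨fun m hm ρ A b hne => ?_, fun m α a b => ?_⟩
  · rw [MTH.unionFeasible_eq_dualFeasible N C f ξ hN l₀ ⟨0, hm⟩ A b]
    exact ⟨MTH.convexOn_objective_dualFeasible N C f ξ A b hN ε ϑ,
      MTH.worstCaseProb_eq_programValue N C f ξ A b hN hξ ϑ hϑ hϑ_sum ε hε hne _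
        (MeasurableSet.iUnion fun j => MTH.measurableSet_polyhedron _ _) rfl⟩
  · have : Fintype (MTH.Selection (MTH.polyhedron C f) a b) := Fintype.ofFinite _
    rw [MTH.complementFeasible_eq_dualFeasible N C f ξ a b]
    refine ⟨MTH.convexOn_objective_dualFeasible N C f ξ _ _ hN ε ϑ,
      MTH.worstCaseProb_eq_programValue N C f ξ _ _ hN hξ ϑ hϑ hϑ_sum ε hε (fun q => ?_) _
        (MTH.measurableSet_compl_iUnion a b) (MTH.compl_iUnion_inter_eq _ a b)⟩
    obtain ⟨x, hx, hxΞ⟩ := q.2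
    exact ⟨x, (MTH.mem_polyhedron_neg_iff a b q.1 x).2 hx, hxΞ⟩
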